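/- Let $p>2$ be a real number. A randomized linear sketch with $r$ rows for vectors in $\mathbb{R}^n$ consists of a random matrix $S\in\mathbb{R}^{r\times n}$ together with a (possibly randomized) measurable estimator which, given $S$ and $Sx$, outputs a real number $\hat F$; the joint distribution of $S$ and the random bits of the estimator does not depend on $x$. The sketch $(\epsilon,\delta)$-approximates $F_p$ if for every fixed $x\in\mathbb{R}^n$, $$\Pr\bigl[\,|\hat F-F_p(x)|\le \epsilon F_p(x)\,\bigr]\ge 1-\delta,\qquad F_p(x)=\|x\|_p^p=\sum_{i=1}^n|x_i|^p .$$ Then for all constants $\epsilon_0,\delta_0\in(0,1)$ there are constants $C>0$ and $c>0$, depending only on $p,\epsilon_0,\delta_0$, such that the following holds for all $n,r$, all $0<\epsilon\le\epsilon_0$ and all $0<\delta\le\delta_0$ with $$\log(1/\delta)\le C\,\epsilon^2 n^{2/p}.$$ If some randomized linear sketch with $r$ rows $(\epsilon,\delta)$-approximates $F_p$ on $\mathbb{R}^n$, then $$r\ \ge\ c\; n^{1-2/p}\,\epsilon^{-2}\log(1/\delta).$$ -/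

import Mathlib

open MeasureTheory

noncomputable section

/-- The frequency moment `F_p(x) = ‖x‖_p^p = ∑ i, |x i| ^ p` of a real vector. -/
def frequencyMoment {n : ℕ} (p : ℝ) (x : Fin n → ℝ) : ℝ :=
  ∑ i, |x i| ^ p

/-- A randomized linear sketch with `r` rows for vectors in `ℝⁿ`, with randomness `ω : Ω`: a random
matrix `S = matrix ω`, and an estimator that outputs a real number from the sketch `S x`. The
estimator may use the whole of `ω`, hence the matrix `S` and further random bits. -/
structure LinearSketch (r n : ℕ) (Ω : Type*) [MeasurableSpace Ω] where
  matrix : Ω → Matrix (Fin r) (Fin n) ℝ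
  measurable_matrix : ∀ i j, Measurable fun ω => matrix ω i j
  estimate : Ω → (Fin r → ℝ) → ℝ
  measurable_estimate : Measurable fun q : Ω × (Fin r → ℝ) => estimate q.1 q.2

/-- The output of the sketching algorithm on input `x` with randomness `ω`. -/
def LinearSketch.output {r n : ℕ} {Ω : Type*} [MeasurableSpace Ω] (A : LinearSketch r n Ω)
    (ω : Ω) (x : Fin n → ℝ) : ℝ :=
  A.estimate ω ((A.matrix ω).mulVec x)

/-- The sketch `(ε, δ)`-approximates `F_p`: for every fixed `x`, with probability at least `1 - δ`,
its output is within a factor `1 ± ε` of `F_p(x)`. -/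
def LinearSketch.Approximates {r n : ℕ} {Ω : Type*} [MeasurableSpace Ω] (A : LinearSketch r n Ω)
    (P : Measure Ω) (p ε δ : ℝ) : Prop :=
  ∀ x : Fin n → ℝ,
    1 - δ ≤ P.real {ω | |A.output ω x - frequencyMoment p x| ≤ ε * frequencyMoment p x}

end

open ProbabilityTheory

/-! A spike is hidden in Gaussian noise. Let `N = n^(1/p)`. The inputs are `g + α_k N e_i` with `g`
standard Gaussian and `K` levels `α_k`, within `O(ε)` of each other, whose values of `F_p`, about `n
β_k^p`, are too far apart to share a `(1 ± ε)`-approximation.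

Fix the matrix `S` and let `q_i` be the projection of `e_i` to its row space. Subtracting `w_k =
(α_k - α_0) N q_i` from the input of level `k` gives it the sketch of level `0`. The estimator then
gives one answer at all levels, and for typical `g` it is right at one level at most
(`not_approx_of_separated`). Undoing the shift costs a factor `exp(-‖w_k‖²)` and a square
(`sq_gaussianPi_preimage_sub_le`).

Since `∑ ‖q_i‖² ≤ r` (`exists_rowSpace_proj`), too small an `r` makes this factor at least `√δ` for
most `i`. Averaging over `i`, `k` and the sketch gives `(1 - κ)(1 - 2κ)² √δ ≤ δ` with `κ = 1/K`,
which is false for large `K`. -/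

/-! ### Gaussian measure and its translates. -/

/-- The standard Gaussian measure on `Fin n → ℝ`. -/
noncomputable def gaussianPi (n : ℕ) : Measure (Fin n → ℝ) :=
  Measure.pi fun _ => gaussianReal 0 1

instance (n : ℕ) : IsProbabilityMeasure (gaussianPi n) := by
  unfold gaussianPi; infer_instance

/-- The density of the standard Gaussian measure on `Fin n → ℝ`. -/
noncomputable def gaussianPiDensity {n : ℕ} (x : Fin n → ℝ) : ℝ :=
  ∏ i, gaussianPDFReal 0 1 (x i)

lemma gaussianPiDensity_nonneg {n : ℕ} (x : Fin n → ℝ) : 0 ≤ gaussianPiDensity x :=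
  Finset.prod_nonneg fun _ _ => gaussianPDFReal_nonneg _ _ _

lemma measurable_gaussianPiDensity {n : ℕ} :
    Measurable (gaussianPiDensity : (Fin n → ℝ) → ℝ) := by
  unfold gaussianPiDensity
  exact Finset.measurable_prod _ fun i _ =>
    (measurable_gaussianPDFReal 0 1).comp (measurable_pi_apply i)

lemma gaussianPi_eq_withDensity (n : ℕ) :
    gaussianPi n =
      (volume : Measure (Fin n → ℝ)).withDensity fun x => ENNReal.ofReal (gaussianPiDensity x) := by
  unfold gaussianPi
  refine Measure.pi_eq fun s hs => ?_
  rw [withDensity_apply _ (MeasurableSet.univ_pi hs), volume_pi, Measure.restrict_pi_pi]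
  unfold gaussianPiDensity
  rw [← ofReal_integral_eq_lintegral_ofReal, integral_fintype_prod_eq_prod,
    ENNReal.ofReal_prod_of_nonneg]
  · exact Finset.prod_congr rfl fun i _ => (gaussianReal_apply_eq_integral 0 one_ne_zero _).symm
  · exact fun i _ => integral_nonneg fun x => gaussianPDFReal_nonneg _ _ _
  · exact Integrable.fintype_prod (f := fun _ => gaussianPDFReal 0 1)
      fun i => (integrable_gaussianPDFReal 0 1).integrableOn
  · exact Filter.Eventually.of_forall fun x =>
      Finset.prod_nonneg fun _ _ => gaussianPDFReal_nonneg _ _ _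

lemma gaussianPi_preimage_sub {n : ℕ} {B : Set (Fin n → ℝ)} (hB : MeasurableSet B)
    (w : Fin n → ℝ) :
    gaussianPi n {g | g - w ∈ B} = ∫⁻ g in B, ENNReal.ofReal (gaussianPiDensity (g + w)) := by
  have hB' : MeasurableSet {g : Fin n → ℝ | g - w ∈ B} := (measurable_id.sub_const w) hB
  rw [gaussianPi_eq_withDensity, withDensity_apply _ hB', ← lintegral_indicator hB',
    ← lintegral_indicator hB, ← lintegral_add_right_eq_self _ w]
  refine lintegral_congr fun g => ?_
  by_cases hg : g ∈ B <;> simp [Set.indicator, hg]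

/-- Completing the square: `g + w` is the midpoint of `g` and `g + 2w`. This prepares the
Cauchy–Schwarz step in the change of measure. -/
lemma gaussianPiDensity_add_sq {n : ℕ} (g w : Fin n → ℝ) :
    gaussianPiDensity (g + w) ^ 2 =
      gaussianPiDensity g * (Real.exp (∑ j, w j ^ 2) * gaussianPiDensity (g + w + w)) := by
  unfold gaussianPiDensity
  rw [Real.exp_sum, ← Finset.prod_pow, ← Finset.prod_mul_distrib, ← Finset.prod_mul_distrib]
  refine Finset.prod_congr rfl fun j _ => ?_
  simp only [gaussianPDFReal, Pi.add_apply]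
  rw [mul_pow, ← Real.exp_nat_mul]
  rw [show ∀ a b c d : ℝ, a * b * (c * (a * d)) = a ^ 2 * (b * c * d) by intros; ring,
    ← Real.exp_add, ← Real.exp_add]
  congr 2
  push_cast
  ring

/-- Change of measure under a translation of the standard Gaussian measure. -/
lemma sq_gaussianPi_preimage_sub_le {n : ℕ} {B : Set (Fin n → ℝ)} (hB : MeasurableSet B)
    (w : Fin n → ℝ) :
    (gaussianPi n).real {g | g - w ∈ B} ^ 2 * Real.exp (-∑ j, w j ^ 2) ≤
      (gaussianPi n).real B := by
  set E := Real.exp (∑ j, w j ^ 2) with hE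
  have hm : Measurable fun g : Fin n → ℝ => ENNReal.ofReal (gaussianPiDensity g) :=
    measurable_gaussianPiDensity.ennreal_ofReal
  have hm2 : Measurable fun g : Fin n → ℝ => ENNReal.ofReal (gaussianPiDensity (g + w + w)) :=
    hm.comp ((measurable_id.add_const w).add_const w)
  -- The shifted density is a geometric mean; Cauchy–Schwarz on `B` separates its factors, and the
  -- second has mass at most `1` before the weight `E`.
  have hpt : ∀ g : Fin n → ℝ, ENNReal.ofReal (gaussianPiDensity (g + w)) =
      ENNReal.ofReal (gaussianPiDensity g) ^ (1 / 2 : ℝ) *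
        (ENNReal.ofReal E * ENNReal.ofReal (gaussianPiDensity (g + w + w))) ^ (1 / 2 : ℝ) := by
    intro g
    rw [← ENNReal.mul_rpow_of_nonneg _ _ (by norm_num), ← ENNReal.ofReal_mul (Real.exp_pos _).le,
      ← ENNReal.ofReal_mul (gaussianPiDensity_nonneg _), ← gaussianPiDensity_add_sq,
      ENNReal.ofReal_rpow_of_nonneg (sq_nonneg _) (by norm_num), ← Real.sqrt_eq_rpow,
      Real.sqrt_sq (gaussianPiDensity_nonneg _)]
  have hcs := ENNReal.lintegral_mul_le_Lp_mul_Lq (volume.restrict B)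
    Real.HolderConjugate.two_two (hm.pow_const (1 / 2 : ℝ)).aemeasurable
    ((hm2.const_mul (ENNReal.ofReal E)).pow_const (1 / 2 : ℝ)).aemeasurable
  simp only [Pi.mul_apply, ← hpt, ← ENNReal.rpow_mul] at hcs
  norm_num at hcs
  have h1 : ∫⁻ g in B, ENNReal.ofReal (gaussianPiDensity g) = gaussianPi n B := by
    rw [gaussianPi_eq_withDensity, withDensity_apply _ hB]
  have h2 : ∫⁻ g in B, ENNReal.ofReal (gaussianPiDensity (g + w + w)) ≤ 1 := by
    have h3 := gaussianPi_preimage_sub hB (w + w)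
    simp only [← add_assoc] at h3
    rw [← h3]
    exact prob_le_one
  rw [← gaussianPi_preimage_sub hB, h1, lintegral_const_mul _ hm2] at hcs
  have h4 : gaussianPi n {g | g - w ∈ B} ^ 2 ≤ gaussianPi n B * ENNReal.ofReal E := by
    calc gaussianPi n {g | g - w ∈ B} ^ 2
        ≤ (gaussianPi n B ^ (1 / 2 : ℝ) * (ENNReal.ofReal E) ^ (1 / 2 : ℝ)) ^ 2 := by
          gcongr
          refine hcs.trans ?_
          norm_num
          gcongr
          exact mul_le_of_le_one_right' h2
      _ = gaussianPi n B * ENNReal.ofReal E := by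
          rw [← ENNReal.mul_rpow_of_nonneg _ _ (by norm_num), ← ENNReal.rpow_natCast,
            ← ENNReal.rpow_mul]
          norm_num
  have h5 : (gaussianPi n).real {g | g - w ∈ B} ^ 2 ≤ (gaussianPi n).real B * E := by
    have := ENNReal.toReal_mono (ENNReal.mul_ne_top (measure_ne_top _ _) ENNReal.ofReal_ne_top) h4
    rwa [ENNReal.toReal_pow, ENNReal.toReal_mul, ENNReal.toReal_ofReal (Real.exp_pos _).le] at this
  rw [Real.exp_neg, ← div_eq_mul_inv]
  exact (div_le_iff₀ (Real.exp_pos _)).2 h5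

/-! ### Leverage scores. -/

/-- The orthogonal projections of the standard basis vectors to the row space of a matrix with `r`
rows have the same images under the matrix, and their squared norms add up to at most `r`. -/
lemma exists_rowSpace_proj {r n : ℕ} (S : Matrix (Fin r) (Fin n) ℝ) :
    ∃ q : Fin n → Fin n → ℝ, (∀ i, S.mulVec (q i) = S.mulVec (Pi.single i 1)) ∧
      ∑ i, ∑ j, q i j ^ 2 ≤ r := by
  let T : EuclideanSpace ℝ (Fin n) →ₗ[ℝ] (Fin r → ℝ) :=
    S.mulVecLin ∘ₗ (WithLp.linearEquiv 2 ℝ (Fin n → ℝ)).toLinearMap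
  have hT : ∀ x, T x = S.mulVec x.ofLp := fun x => rfl
  let V := (LinearMap.ker T)ᗮ
  have hdim : Module.finrank ℝ V ≤ r := by
    have h1 := (LinearMap.ker T).finrank_add_finrank_orthogonal
    have h2 := T.finrank_range_add_finrank_ker
    have h3 := LinearMap.finrank_le_finrank_of_injective (LinearMap.range T).injective_subtype
    simp only [Module.finrank_fin_fun] at h3
    change Module.finrank ℝ (LinearMap.ker T)ᗮ ≤ r
    omega
  let b := stdOrthonormalBasis ℝ V
  let e := EuclideanSpace.basisFun (Fin n) ℝ
  refine ⟨fun i => (V.starProjection (e i)).ofLp, fun i => ?_, ?_⟩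
  · have h := V.sub_starProjection_mem_orthogonal (e i)
    rw [Submodule.orthogonal_orthogonal, LinearMap.mem_ker, map_sub, sub_eq_zero] at h
    rw [← hT, ← h, hT]
    simp [e]
  -- The trace of a projection: exchanging the sums over `e i` and over an orthonormal basis of `V`
  -- leaves `dim V` unit norms.
  · have key : ∀ i, ∑ j, (V.starProjection (e i)).ofLp j ^ 2 =
        ∑ k, inner ℝ (b k : EuclideanSpace ℝ (Fin n)) (e i) ^ 2 := by
      intro i
      have h1 := EuclideanSpace.real_norm_sq_eq (V.starProjection (e i))
      rw [← h1]
      have h2 := b.sum_sq_norm_inner_right (V.orthogonalProjectionOnto (e i))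
      rw [Submodule.starProjection_apply, ← Submodule.coe_norm, ← h2]
      refine Finset.sum_congr rfl fun k _ => ?_
      rw [Real.norm_eq_abs, sq_abs, Submodule.inner_orthogonalProjectionOnto_eq_of_mem_left]
    simp only [key]
    rw [Finset.sum_comm]
    have : ∀ k, ∑ i, inner ℝ (b k : EuclideanSpace ℝ (Fin n)) (e i) ^ 2 = 1 := by
      intro k
      have h1 := e.sum_sq_norm_inner_left (b k : EuclideanSpace ℝ (Fin n))
      simp only [Real.norm_eq_abs, sq_abs] at h1
      rw [h1]
      have := b.orthonormal.1 k
      rw [← Submodule.coe_norm, this, one_pow]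
    simp only [this]
    simpa using hdim

/-! ### Typical Gaussian vectors. -/

lemma memLp_two_abs_rpow_gaussianReal {p : ℝ} (hp : 0 < p) :
    MemLp (fun x : ℝ => |x| ^ p) 2 (gaussianReal 0 1) := by
  have h := memLp_id_gaussianReal' (μ := 0) (v := 1) (2 * ENNReal.ofReal p)
    (ENNReal.mul_ne_top (by norm_num) ENNReal.ofReal_ne_top)
  have h2 := h.norm_rpow_div (ENNReal.ofReal p)
  have hp0 : ENNReal.ofReal p ≠ 0 := by simpa using hp
  rw [ENNReal.mul_div_cancel_right hp0 ENNReal.ofReal_ne_top, ENNReal.toReal_ofReal hp.le] at h2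
  simpa [Real.norm_eq_abs] using h2

/-- The absolute moment of order `p` of a standard Gaussian. -/
noncomputable def gaussianAbsMoment (p : ℝ) : ℝ :=
  ∫ x, |x| ^ p ∂gaussianReal 0 1

lemma gaussianAbsMoment_nonneg (p : ℝ) : 0 ≤ gaussianAbsMoment p :=
  integral_nonneg fun x => Real.rpow_nonneg (abs_nonneg x) p

/-- The vectors whose frequency moment deviates by less than `t` from the mean under the standard
Gaussian measure, and whose coordinate `i` is less than `s` in absolute value. -/
def typicalSet {n : ℕ} (p : ℝ) (i : Fin n) (t s : ℝ) : Set (Fin n → ℝ) :=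
  {g | |frequencyMoment p g - n * gaussianAbsMoment p| < t ∧ |g i| < s}

lemma gaussianPi_compl_typicalSet_le {n : ℕ} {p : ℝ} (hp : 0 < p) (i : Fin n) {t s : ℝ}
    (ht : 0 < t) (hs : 0 < s) :
    (gaussianPi n).real (typicalSet p i t s)ᶜ ≤
      n * Var[fun x : ℝ => |x| ^ p; gaussianReal 0 1] / t ^ 2 + 1 / s ^ 2 := by
  have hL := memLp_two_abs_rpow_gaussianReal hp
  have hLi : ∀ j : Fin n, MemLp (fun g : Fin n → ℝ => |g j| ^ p) 2 (gaussianPi n) := fun j =>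
    hL.comp_measurePreserving (measurePreserving_eval (fun _ : Fin n => gaussianReal 0 1) j)
  have hF : MemLp (frequencyMoment p : (Fin n → ℝ) → ℝ) 2 (gaussianPi n) := by
    unfold frequencyMoment
    exact memLp_finsetSum _ fun j _ => hLi j
  have hmean : (gaussianPi n)[(frequencyMoment p : (Fin n → ℝ) → ℝ)] =
      n * gaussianAbsMoment p := by
    unfold frequencyMoment
    rw [integral_finsetSum _ fun j _ => (hLi j).integrable one_le_two]
    have : ∀ j : Fin n, ∫ g, |g j| ^ p ∂gaussianPi n = gaussianAbsMoment p := fun j =>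
      integral_comp_eval (μ := fun _ : Fin n => gaussianReal 0 1) (i := j)
        (f := fun x : ℝ => |x| ^ p) hL.aestronglyMeasurable
    simp [this]
  have hvar : Var[(frequencyMoment p : (Fin n → ℝ) → ℝ); gaussianPi n] =
      n * Var[fun x : ℝ => |x| ^ p; gaussianReal 0 1] := by
    have h := variance_sum_pi (μ := fun _ : Fin n => gaussianReal 0 1)
      (X := fun _ (x : ℝ) => |x| ^ p) fun _ => hL
    have h2 : (frequencyMoment p : (Fin n → ℝ) → ℝ) = ∑ j, fun g : Fin n → ℝ => |g j| ^ p := by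
      ext g; simp [frequencyMoment]
    rw [h2]
    refine h.trans ?_
    simp
  have h1 : (gaussianPi n).real {g | t ≤ |frequencyMoment p g - n * gaussianAbsMoment p|} ≤
      n * Var[fun x : ℝ => |x| ^ p; gaussianReal 0 1] / t ^ 2 := by
    have h := meas_ge_le_variance_div_sq hF ht
    rw [hmean, hvar] at h
    exact ENNReal.toReal_le_of_le_ofReal
      (div_nonneg (mul_nonneg (Nat.cast_nonneg _) (variance_nonneg _ _)) (sq_nonneg _)) h
  have h2 : (gaussianPi n).real {g | s ≤ |g i|} ≤ 1 / s ^ 2 := by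
    have hid : MemLp (fun x : ℝ => x) 2 (gaussianReal 0 1) :=
      memLp_id_gaussianReal' (μ := 0) (v := 1) 2 (by norm_num)
    have h := meas_ge_le_variance_div_sq hid hs
    rw [variance_fun_id_gaussianReal, integral_id_gaussianReal] at h
    have hms : MeasurableSet {x : ℝ | s ≤ |x|} :=
      measurableSet_le measurable_const measurable_norm
    have h3 := (measurePreserving_eval (fun _ : Fin n => gaussianReal 0 1) i).measure_preimage
      hms.nullMeasurableSet
    have h4 : gaussianPi n {g | s ≤ |g i|} = gaussianReal 0 1 {x : ℝ | s ≤ |x|} := h3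
    rw [measureReal_def, h4]
    refine ENNReal.toReal_le_of_le_ofReal (by positivity) ?_
    simpa using h
  refine (measureReal_mono ?_).trans ((measureReal_union_le _ _).trans (add_le_add h1 h2))
  intro g hg
  simp only [typicalSet, Set.mem_compl_iff, Set.mem_ofPred_eq, not_and_or, not_lt] at hg
  exact hg

/-! ### The `p`-norm of planted vectors. -/

lemma frequencyMoment_nonneg {n : ℕ} (p : ℝ) (x : Fin n → ℝ) : 0 ≤ frequencyMoment p x :=
  Finset.sum_nonneg fun _ _ => Real.rpow_nonneg (abs_nonneg _) _

lemma measurable_frequencyMoment {n : ℕ} (p : ℝ) :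
    Measurable (frequencyMoment p : (Fin n → ℝ) → ℝ) := by
  unfold frequencyMoment
  exact Finset.measurable_sum _ fun i _ => (measurable_pi_apply i).abs.pow_const p

lemma frequencyMoment_rpow_add_le {n : ℕ} {p : ℝ} (hp : 1 ≤ p) (x y : Fin n → ℝ) :
    frequencyMoment p (x + y) ^ (1 / p) ≤
      frequencyMoment p x ^ (1 / p) + frequencyMoment p y ^ (1 / p) :=
  Real.Lp_add_le Finset.univ x y hp

lemma frequencyMoment_neg {n : ℕ} (p : ℝ) (x : Fin n → ℝ) :
    frequencyMoment p (-x) = frequencyMoment p x := by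
  simp [frequencyMoment]

/-- For `p > 2` the `p`-norm is at most the Euclidean norm, so a shift that is cheap for the
Gaussian measure barely changes the `p`-norm. -/
lemma frequencyMoment_rpow_le_of_sum_sq_le {n : ℕ} {p : ℝ} (hp : 2 < p) {w : Fin n → ℝ} {d : ℝ}
    (hd : 0 ≤ d) (hw : ∑ j, w j ^ 2 ≤ d ^ 2) : frequencyMoment p w ^ (1 / p) ≤ d := by
  have hle : ∀ j, |w j| ≤ d := fun j => abs_le_of_sq_le_sq
    ((Finset.single_le_sum (fun j _ => sq_nonneg (w j)) (Finset.mem_univ j)).trans hw) hd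
  have h : frequencyMoment p w ≤ d ^ p := by
    calc frequencyMoment p w ≤ ∑ j, w j ^ 2 * d ^ (p - 2) := by
          refine Finset.sum_le_sum fun j _ => ?_
          have h1 : |w j| ^ p = w j ^ 2 * |w j| ^ (p - 2) := by
            rcases eq_or_ne (w j) 0 with h0 | h0
            · rw [h0, abs_zero, Real.zero_rpow (by linarith)]; simp
            · rw [← sq_abs, ← Real.rpow_natCast, ← Real.rpow_add (abs_pos.2 h0)]
              norm_num
          rw [h1]
          exact mul_le_mul_of_nonneg_left
            (Real.rpow_le_rpow (abs_nonneg _) (hle j) (by linarith)) (sq_nonneg _)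
      _ ≤ d ^ 2 * d ^ (p - 2) := by
          rw [← Finset.sum_mul]
          exact mul_le_mul_of_nonneg_right hw (Real.rpow_nonneg hd _)
      _ = d ^ p := by
          rcases hd.eq_or_lt with rfl | h0
          · rw [Real.zero_rpow (by linarith : p ≠ 0)]; simp
          · rw [← Real.rpow_natCast, ← Real.rpow_add h0]; norm_num
  calc frequencyMoment p w ^ (1 / p) ≤ (d ^ p) ^ (1 / p) :=
        Real.rpow_le_rpow (frequencyMoment_nonneg _ _) h (by positivity)
    _ = d := by rw [one_div, Real.rpow_rpow_inv hd (by linarith)]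

lemma frequencyMoment_update {n : ℕ} (p : ℝ) (g : Fin n → ℝ) (i : Fin n) (a : ℝ) :
    frequencyMoment p (Function.update g i a) = frequencyMoment p g - |g i| ^ p + |a| ^ p := by
  unfold frequencyMoment
  rw [← Finset.add_sum_erase _ _ (Finset.mem_univ i),
    ← Finset.add_sum_erase _ (fun j => |g j| ^ p) (Finset.mem_univ i)]
  rw [Finset.sum_congr rfl fun j hj => by
    rw [Function.update_of_ne (Finset.ne_of_mem_erase hj)]]
  simp
  ring

/-- Overwriting coordinate `i`, rather than adding to it, makes the planted moment an exact sum;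
half of the error budget pays for the noise and half for the lost term `|g i| ^ p`. -/
lemma abs_frequencyMoment_update_sub_le {n : ℕ} {p : ℝ} (hp : 2 < p) {ε N α β : ℝ}
    (hε : 0 < ε) (hε1 : ε < 1) (hN : 0 < N) (hNp : N ^ p = n) (hα : 0 ≤ α)
    (hαβ : β ^ p = α ^ p + gaussianAbsMoment p) {i : Fin n} {g : Fin n → ℝ}
    (hg : g ∈ typicalSet p i (ε * n / 48) (ε * N / 24)) :
    |frequencyMoment p (Function.update g i (α * N)) - n * β ^ p| ≤ ε * n / 24 := by
  obtain ⟨h1, h2⟩ := hg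
  rw [frequencyMoment_update, abs_of_nonneg (mul_nonneg hα hN.le), Real.mul_rpow hα hN.le, hNp, hαβ]
  have h3 : |g i| ^ p ≤ ε * n / 48 := by
    calc |g i| ^ p ≤ (ε / 24 * N) ^ p :=
          Real.rpow_le_rpow (abs_nonneg _) (by linarith) (by linarith)
      _ = (ε / 24) ^ p * n := by rw [Real.mul_rpow (by positivity) hN.le, hNp]
      _ ≤ (ε / 24) ^ (2 : ℝ) * n := by
          gcongr ?_ * _
          exact Real.rpow_le_rpow_of_exponent_ge (by positivity) (by linarith) hp.le
      _ ≤ ε * n / 48 := by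
          have hn : (0 : ℝ) ≤ n := Nat.cast_nonneg n
          rw [Real.rpow_two]
          have : (ε / 24) ^ 2 ≤ ε / 48 := by nlinarith
          calc (ε / 24) ^ 2 * n ≤ ε / 48 * n := by gcongr
            _ = _ := by ring
  have h4 : 0 ≤ |g i| ^ p := Real.rpow_nonneg (abs_nonneg _) _
  rw [abs_lt] at h1
  rw [abs_le]
  constructor <;> nlinarith

/-- The frequency moment of a planted typical vector, after a small perturbation. -/
lemma frequencyMoment_planted_mem {n : ℕ} {p : ℝ} (hp : 2 < p) {ε N α β : ℝ}
    (hε : 0 < ε) (hε1 : ε < 1) (hN : 0 < N) (hNp : N ^ p = n) (hα : 0 ≤ α) (hβ : 1 ≤ β)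
    (hαβ : β ^ p = α ^ p + gaussianAbsMoment p) {i : Fin n} {g w : Fin n → ℝ}
    (hg : g ∈ typicalSet p i (ε * n / 48) (ε * N / 24)) (hw : ∑ j, w j ^ 2 ≤ (ε * N / 24) ^ 2) :
    frequencyMoment p (g + (α * N) • Pi.single i 1 - w) ^ (1 / p) ∈
      Set.Icc (β * N * (1 - ε / 8)) (β * N * (1 + ε / 8)) := by
  have hp0 : 0 < p := by linarith
  have hn : (0 : ℝ) ≤ n := Nat.cast_nonneg n
  have hβ0 : 0 ≤ β := by linarith
  have hβp : 1 ≤ β ^ p := Real.one_le_rpow hβ hp0.le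
  have hu := abs_le.1 (abs_frequencyMoment_update_sub_le hp hε hε1 hN hNp hα hαβ hg)
  -- The vector `x` differs from `u` by `g i` at `i` and by `w`, each of `p`-norm at most `εN/24`.
  -- The norm of `u` is known within a factor `1 ± ε/24`; Minkowski in both directions adds the
  -- three errors up to `ε/8`.
  set u := Function.update g i (α * N) with hu_def
  set x := g + (α * N) • Pi.single i 1 - w with hx
  set s : Fin n → ℝ := Pi.single i (g i) with hs
  have hx1 : x = u + s + -w := by
    ext j
    by_cases hj : j = i
    · subst hj; simp [hx, hu_def, hs]; ring
    · simp [hx, hu_def, hs, hj]; ring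
  have hu1 : u = x + -s + w := by rw [hx1]; abel
  have hsF : frequencyMoment p s ^ (1 / p) ≤ ε * N / 24 := by
    refine frequencyMoment_rpow_le_of_sum_sq_le hp (by positivity) ?_
    have : ∑ j, s j ^ 2 = g i ^ 2 := by
      rw [Finset.sum_eq_single i]
      · simp [hs]
      · intro j _ hj; simp [hs, hj]
      · simp
    rw [this]
    exact sq_le_sq' (abs_lt.1 hg.2).1.le (abs_lt.1 hg.2).2.le
  have hwF : frequencyMoment p w ^ (1 / p) ≤ ε * N / 24 :=
    frequencyMoment_rpow_le_of_sum_sq_le hp (by positivity) hw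
  have t1 := frequencyMoment_rpow_add_le (by linarith : 1 ≤ p) (u + s) (-w)
  have t2 := frequencyMoment_rpow_add_le (by linarith : 1 ≤ p) u s
  have t3 := frequencyMoment_rpow_add_le (by linarith : 1 ≤ p) (x + -s) w
  have t4 := frequencyMoment_rpow_add_le (by linarith : 1 ≤ p) x (-s)
  rw [← hx1, frequencyMoment_neg] at t1
  rw [← hu1] at t3
  rw [frequencyMoment_neg] at t4
  have hroot : ∀ {a b : ℝ}, 0 ≤ a → a ≤ b ^ p → 0 ≤ b → a ^ (1 / p) ≤ b := by
    intro a b ha hab hb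
    calc a ^ (1 / p) ≤ (b ^ p) ^ (1 / p) := Real.rpow_le_rpow ha hab (by positivity)
      _ = b := by rw [one_div, Real.rpow_rpow_inv hb hp0.ne']
  have hroot' : ∀ {a b : ℝ}, b ^ p ≤ a → 0 ≤ b → b ≤ a ^ (1 / p) := by
    intro a b hab hb
    calc b = (b ^ p) ^ (1 / p) := by rw [one_div, Real.rpow_rpow_inv hb hp0.ne']
      _ ≤ a ^ (1 / p) := Real.rpow_le_rpow (Real.rpow_nonneg hb _) hab (by positivity)
  have hεn : ε * n / 24 ≤ n * β ^ p * (ε / 24) := by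
    nlinarith [mul_nonneg (mul_nonneg hε.le hn) (sub_nonneg.2 hβp)]
  have hup : frequencyMoment p u ^ (1 / p) ≤ β * N * (1 + ε / 24) := by
    refine hroot (frequencyMoment_nonneg _ _) ?_ (by positivity)
    rw [Real.mul_rpow (by positivity) (by positivity), Real.mul_rpow hβ0 hN.le, hNp]
    have h1 : 1 + ε / 24 ≤ (1 + ε / 24) ^ p :=
      Real.self_le_rpow_of_one_le (by linarith) (by linarith)
    have h2 := mul_le_mul_of_nonneg_left h1 (mul_nonneg (by linarith : 0 ≤ β ^ p) hn)
    nlinarith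
  have hlow : β * N * (1 - ε / 24) ≤ frequencyMoment p u ^ (1 / p) := by
    have h0 : 0 ≤ 1 - ε / 24 := by linarith
    refine hroot' ?_ (by positivity)
    rw [Real.mul_rpow (by positivity) h0, Real.mul_rpow hβ0 hN.le, hNp]
    have h1 : (1 - ε / 24) ^ p ≤ 1 - ε / 24 :=
      Real.rpow_le_self_of_le_one h0 (by linarith) (by linarith)
    have h2 := mul_le_mul_of_nonneg_left h1 (mul_nonneg (by linarith : 0 ≤ β ^ p) hn)
    nlinarith
  have hNβ : ε * N ≤ β * N * ε := by
    nlinarith [mul_nonneg (mul_nonneg hε.le hN.le) (sub_nonneg.2 hβ)]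
  constructor <;> linarith

/-! ### Separated levels. -/

/-- Values in well separated windows have no common `(1 ± ε)`-approximation. -/
lemma not_approx_of_separated {p ε Λ N β β' X X' z : ℝ} (hp : 1 ≤ p) (hε : 0 < ε) (hε1 : ε < 1)
    (hΛ : 2 ≤ Λ) (hΛε : 2 ≤ Λ * (1 - ε)) (hN : 0 < N) (hβ : 0 < β)
    (hββ : (1 + 8 * Λ * ε) * β ≤ β') (hX0 : 0 ≤ X) (hX0' : 0 ≤ X')
    (hX : X ^ (1 / p) ∈ Set.Icc (β * N * (1 - ε / 8)) (β * N * (1 + ε / 8)))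
    (hX' : X' ^ (1 / p) ∈ Set.Icc (β' * N * (1 - ε / 8)) (β' * N * (1 + ε / 8)))
    (hz : |z - X| ≤ ε * X) (hz' : |z - X'| ≤ ε * X') : False := by
  have h1 : (1 - ε) * X' ≤ (1 + ε) * X := by
    have := (abs_le.1 hz).2
    have := (abs_le.1 hz').1
    linarith
  have h2 : X' ≤ (1 + Λ * ε) * X := by
    -- `Λ(1 - ε) ≥ 2` says exactly that `(1 + ε)/(1 - ε) ≤ 1 + Λε`.
    have h3 : (1 + ε) * X ≤ (1 - ε) * ((1 + Λ * ε) * X) := by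
      nlinarith [mul_nonneg (mul_nonneg hε.le hX0) (sub_nonneg.2 hΛε)]
    exact le_of_mul_le_mul_left (h1.trans h3) (by linarith)
  have hΛ1 : 1 ≤ 1 + Λ * ε := by nlinarith
  have h4 : X' ^ (1 / p) ≤ (1 + Λ * ε) * X ^ (1 / p) := by
    calc X' ^ (1 / p) ≤ ((1 + Λ * ε) * X) ^ (1 / p) :=
          Real.rpow_le_rpow hX0' h2 (by positivity)
      _ = (1 + Λ * ε) ^ (1 / p) * X ^ (1 / p) := Real.mul_rpow (by linarith) hX0
      _ ≤ (1 + Λ * ε) * X ^ (1 / p) := by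
          refine mul_le_mul_of_nonneg_right ?_ (Real.rpow_nonneg hX0 _)
          exact Real.rpow_le_self_of_one_le hΛ1 ((div_le_one (by linarith)).2 hp)
  have h5 : (1 + 8 * Λ * ε) * β * N * (1 - ε / 8) ≤ (1 + Λ * ε) * (β * N * (1 + ε / 8)) := by
    calc (1 + 8 * Λ * ε) * β * N * (1 - ε / 8) ≤ β' * N * (1 - ε / 8) := by
          gcongr
          linarith
      _ ≤ X' ^ (1 / p) := hX'.1
      _ ≤ (1 + Λ * ε) * X ^ (1 / p) := h4
      _ ≤ _ := mul_le_mul_of_nonneg_left hX.2 (by linarith)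
  have h6 : (1 + 8 * Λ * ε) * (1 - ε / 8) ≤ (1 + Λ * ε) * (1 + ε / 8) := by
    have hβN : 0 < β * N := mul_pos hβ hN
    refine le_of_mul_le_mul_left ?_ hβN
    linarith
  have h7 : 0 ≤ ε * Λ * (1 - ε) := by
    have : 0 ≤ Λ := by linarith
    have : 0 ≤ 1 - ε := by linarith
    positivity
  nlinarith [mul_le_mul_of_nonneg_left hΛ hε.le]

/-- Planted levels `α k` for which the total `p`-norms `β k` grow geometrically. -/
lemma exists_levels {p Λ : ℝ} (hp : 2 < p) (hΛ : 2 ≤ Λ) {K : ℕ} (hK : 0 < K) :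
    ∃ M : ℝ, 0 < M ∧ ∀ ε : ℝ, 0 < ε → ε < 1 → ∃ α β : ℕ → ℝ,
      (∀ k, 1 ≤ β k) ∧ (∀ k, 0 ≤ α k) ∧ (∀ k, β k ^ p = α k ^ p + gaussianAbsMoment p) ∧
      (∀ k l, k < l → (1 + 8 * Λ * ε) * β k ≤ β l) ∧
      ∀ k, k < K → 0 ≤ α k - α 0 ∧ α k - α 0 ≤ M * ε := by
  set m := gaussianAbsMoment p with hm
  have hm0 : 0 ≤ m := gaussianAbsMoment_nonneg p
  have hp0 : 0 < p := by linarith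
  have hK' : (0 : ℝ) < K := Nat.cast_pos.2 hK
  set y := 8 * Λ * K * p with hy
  have hy0 : 0 < y := by positivity
  -- `M` must not depend on `ε`: for `k < K` the growth of `β k ^ p` is at most `exp (yε)`, and `exp
  -- (yε) - 1 ≤ y exp(y) ε` as `ε < 1`.
  refine ⟨(m + 1) * (y * Real.exp y), by positivity, fun ε hε hε1 => ?_⟩
  set τ := 1 + 8 * Λ * ε with hτ
  have hτ1 : 1 ≤ τ := by
    have : 0 ≤ 8 * Λ * ε := by positivity
    linarith
  have hτk : ∀ k : ℕ, 1 ≤ τ ^ k := fun k => one_le_pow₀ hτ1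
  have hτkp : ∀ k : ℕ, 1 ≤ (τ ^ k) ^ p := fun k => Real.one_le_rpow (hτk k) hp0.le
  have hb : ∀ k : ℕ, 0 ≤ (m + 1) * (τ ^ k) ^ p - m := fun k => by nlinarith [hτkp k]
  have hb1 : ∀ k : ℕ, 1 ≤ (m + 1) * (τ ^ k) ^ p - m := fun k => by nlinarith [hτkp k]
  have hα1 : ∀ k : ℕ, 1 ≤ ((m + 1) * (τ ^ k) ^ p - m) ^ (1 / p) := fun k =>
    Real.one_le_rpow (hb1 k) (by positivity)
  have hα0 : ((m + 1) * (τ ^ 0) ^ p - m) ^ (1 / p) = 1 := by simp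
  -- The factor `m + 1` makes `α 0 = 1` and keeps the radicand at least `1`, where the `p`-th root
  -- does not exceed its argument.
  refine ⟨fun k => ((m + 1) * (τ ^ k) ^ p - m) ^ (1 / p), fun k => (m + 1) ^ (1 / p) * τ ^ k,
    fun k => ?_, fun k => by linarith [hα1 k], fun k => ?_, fun k l hkl => ?_, fun k hk => ?_⟩
  · exact one_le_mul_of_one_le_of_one_le (Real.one_le_rpow (by linarith) (by positivity)) (hτk k)
  · rw [Real.mul_rpow (by positivity) (by linarith [hτk k]), one_div,
      Real.rpow_inv_rpow (by positivity) hp0.ne', Real.rpow_inv_rpow (hb k) hp0.ne']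
    ring
  · have h1 : τ ^ (k + 1) ≤ τ ^ l := pow_le_pow_right₀ hτ1 hkl
    calc τ * ((m + 1) ^ (1 / p) * τ ^ k) = (m + 1) ^ (1 / p) * τ ^ (k + 1) := by ring
      _ ≤ _ := mul_le_mul_of_nonneg_left h1 (by positivity)
  · simp only [hα0]
    refine ⟨by linarith [hα1 k], ?_⟩
    have h1 : ((m + 1) * (τ ^ k) ^ p - m) ^ (1 / p) ≤ (m + 1) * (τ ^ k) ^ p - m :=
      Real.rpow_le_self_of_one_le (hb1 k) ((div_le_one hp0).2 (by linarith))
    have h2 : (τ ^ k) ^ p ≤ Real.exp (y * ε) := by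
      calc (τ ^ k) ^ p ≤ (Real.exp (8 * Λ * ε) ^ k) ^ p := by
            refine Real.rpow_le_rpow (by linarith [hτk k]) ?_ hp0.le
            exact pow_le_pow_left₀ (by linarith) (by linarith [Real.add_one_le_exp (8 * Λ * ε)]) k
        _ = Real.exp (k * (8 * Λ * ε) * p) := by
            rw [← Real.exp_nat_mul, Real.exp_mul (k * (8 * Λ * ε))]
        _ ≤ Real.exp (y * ε) := by
            refine Real.exp_le_exp.2 ?_
            have : (k : ℝ) ≤ K := by exact_mod_cast hk.le
            calc k * (8 * Λ * ε) * p ≤ K * (8 * Λ * ε) * p := by gcongr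
              _ = y * ε := by rw [hy]; ring
    have h3 : Real.exp (y * ε) - 1 ≤ y * Real.exp y * ε := by
      have h4 := Real.add_one_le_exp (-(y * ε))
      have h5 : Real.exp (y * ε) * Real.exp (-(y * ε)) = 1 := by rw [← Real.exp_add]; simp
      have h6 : Real.exp (y * ε) - 1 ≤ y * ε * Real.exp (y * ε) := by
        nlinarith [mul_le_mul_of_nonneg_left h4 (Real.exp_pos (y * ε)).le]
      have h7 : Real.exp (y * ε) ≤ Real.exp y := Real.exp_le_exp.2 (by nlinarith)
      calc Real.exp (y * ε) - 1 ≤ y * ε * Real.exp (y * ε) := h6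
        _ ≤ y * ε * Real.exp y := by gcongr
        _ = _ := by ring
    have h8 : (m + 1) * ((τ ^ k) ^ p - 1) ≤ (m + 1) * (y * Real.exp y * ε) :=
      mul_le_mul_of_nonneg_left (by linarith) (by linarith)
    linarith

/-! ### Errors of a fixed estimator. -/

/-- The vectors `x` for which `z x` is a `(1 ± ε)`-approximation of the frequency moment. -/
def approxSet {n : ℕ} (p ε : ℝ) (z : (Fin n → ℝ) → ℝ) : Set (Fin n → ℝ) :=
  {x | |z x - frequencyMoment p x| ≤ ε * frequencyMoment p x}

lemma measurableSet_approxSet {n : ℕ} (p ε : ℝ) {z : (Fin n → ℝ) → ℝ} (hz : Measurable z) :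
    MeasurableSet (approxSet p ε z) :=
  measurableSet_le (hz.sub (measurable_frequencyMoment p)).abs
    ((measurable_frequencyMoment p).const_mul ε)

/-- If at most one of `K` events can occur at points of `T`, then the complements of the
events have large total probability. -/
lemma sum_measureReal_compl_ge {X : Type*} [MeasurableSpace X] {μ : Measure X}
    [IsProbabilityMeasure μ] {K : ℕ} {G : ℕ → Set X} (hG : ∀ k, MeasurableSet (G k)) {T : Set X}
    (hT : MeasurableSet T) (hdisj : ∀ x ∈ T, ∀ k < K, ∀ l < K, x ∈ G k → x ∈ G l → k = l) :
    K - 1 - K * μ.real Tᶜ ≤ ∑ k ∈ Finset.range K, μ.real (G k)ᶜ := by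
  have h1 : ∑ k ∈ Finset.range K, μ.real (G k ∩ T) ≤ 1 := by
    rw [← measureReal_biUnion_finset]
    · exact measureReal_le_one
    · intro k hk l hl hkl
      refine Set.disjoint_left.2 fun x hx hx' => hkl ?_
      exact hdisj x hx.2 k (by simpa using hk) l (by simpa using hl) hx.1 hx'.1
    · exact fun k _ => (hG k).inter hT
  have h2 : ∀ k ∈ Finset.range K, 1 - μ.real Tᶜ - μ.real (G k ∩ T) ≤ μ.real (G k)ᶜ := by
    intro k _
    rw [probReal_compl_eq_one_sub (hG k)]
    have h3 : μ.real (G k) ≤ μ.real (G k ∩ T) + μ.real Tᶜ := by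
      refine (measureReal_mono ?_).trans (measureReal_union_le _ _)
      intro x hx
      by_cases hxT : x ∈ T
      · exact Or.inl ⟨hx, hxT⟩
      · exact Or.inr hxT
    linarith
  refine le_trans ?_ (Finset.sum_le_sum h2)
  simp only [Finset.sum_sub_distrib, Finset.sum_const, Finset.card_range, nsmul_eq_mul]
  linarith

/-- For a fixed estimator, a coordinate `i` of small leverage forces errors on the
planted inputs `g + a e_i`, summed over the levels `a`. -/
lemma sum_gaussianPi_error_ge {n r : ℕ} {p : ℝ} (hp : 2 < p) {ε Λ N M ρ κ : ℝ} {K : ℕ}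
    (hε : 0 < ε) (hε1 : ε < 1) (hΛ : 2 ≤ Λ) (hΛε : 2 ≤ Λ * (1 - ε))
    (hN : 0 < N) (hNp : N ^ p = n) {α β : ℕ → ℝ} (hβ : ∀ k, 1 ≤ β k) (hα : ∀ k, 0 ≤ α k)
    (hαβ : ∀ k, β k ^ p = α k ^ p + gaussianAbsMoment p)
    (hβτ : ∀ k l, k < l → (1 + 8 * Λ * ε) * β k ≤ β l)
    (hαM : ∀ k, k < K → 0 ≤ α k - α 0 ∧ α k - α 0 ≤ M * ε)
    (S : Matrix (Fin r) (Fin n) ℝ) {est : (Fin r → ℝ) → ℝ} (hest : Measurable est)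
    (i : Fin n) {q : Fin n → ℝ} (hq : S.mulVec q = S.mulVec (Pi.single i 1))
    (hqρ : ∑ j, q j ^ 2 ≤ ρ) (hρ : (M * ε * N) ^ 2 * ρ ≤ (ε * N / 24) ^ 2)
    (hκ : K * κ = 1) (hκ2 : κ ≤ 1 / 2)
    (htyp : (gaussianPi n).real (typicalSet p i (ε * n / 48) (ε * N / 24))ᶜ ≤ κ) :
    K * (1 - 2 * κ) ^ 2 * Real.exp (-((M * ε * N) ^ 2 * ρ)) ≤
      ∑ k ∈ Finset.range K, (gaussianPi n).real
        {g | g + (α k * N) • Pi.single i 1 ∉ approxSet p ε fun x => est (S.mulVec x)} := by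
  set z : (Fin n → ℝ) → ℝ := fun x => est (S.mulVec x) with hz
  have hzm : Measurable z := hest.comp (by
    have : Continuous fun x : Fin n → ℝ => S.mulVec x := by fun_prop
    exact this.measurable)
  have hA := measurableSet_approxSet p ε hzm
  set w : ℕ → Fin n → ℝ := fun k => ((α k - α 0) * N) • q with hw
  set a : ℕ → Fin n → ℝ := fun k => (α k * N) • Pi.single i 1 with ha
  have hwsum : ∀ k < K, ∑ j, w k j ^ 2 ≤ (M * ε * N) ^ 2 * ρ := by
    intro k hk
    have h1 : ∑ j, w k j ^ 2 = ((α k - α 0) * N) ^ 2 * ∑ j, q j ^ 2 := by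
      rw [Finset.mul_sum]
      exact Finset.sum_congr rfl fun j _ => by simp [hw]; ring
    rw [h1]
    have h2 := hαM k hk
    have h3 : 0 ≤ ∑ j, q j ^ 2 := Finset.sum_nonneg fun _ _ => sq_nonneg _
    have h4 : ((α k - α 0) * N) ^ 2 ≤ (M * ε * N) ^ 2 :=
      pow_le_pow_left₀ (mul_nonneg h2.1 hN.le) (mul_le_mul_of_nonneg_right h2.2 hN.le) 2
    gcongr
  have hzw : ∀ g k, z (g + a k - w k) = z (g + a 0) := by
    intro g k
    simp only [hz, ha, hw]
    congr 1
    rw [Matrix.mulVec_sub, Matrix.mulVec_add, Matrix.mulVec_add, Matrix.mulVec_smul,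
      Matrix.mulVec_smul, Matrix.mulVec_smul, hq, add_sub_assoc, ← sub_smul]
    congr 2
    ring
  have hmeas : ∀ k, MeasurableSet {g : Fin n → ℝ | g + a k ∈ approxSet p ε z} := fun k =>
    (measurable_id.add_const (a k)) hA
  have hmeas' : ∀ k, MeasurableSet {g : Fin n → ℝ | g + a k - w k ∈ approxSet p ε z} := fun k =>
    ((measurable_id.add_const (a k)).sub_const (w k)) hA
  have hT : MeasurableSet (typicalSet p i (ε * n / 48) (ε * N / 24)) :=
    (measurableSet_lt ((measurable_frequencyMoment p).sub_const _).abs measurable_const).inter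
      (measurableSet_lt (measurable_pi_apply i).abs measurable_const)
  have hsep : ∀ g ∈ typicalSet p i (ε * n / 48) (ε * N / 24), ∀ k < K, ∀ l < K, k < l →
      g + a k - w k ∈ approxSet p ε z → g + a l - w l ∈ approxSet p ε z → False := by
    intro g hg k hk l hl hkl hgk hgl
    have hgk' : |z (g + a k - w k) - frequencyMoment p (g + a k - w k)| ≤ _ := hgk
    have hgl' : |z (g + a l - w l) - frequencyMoment p (g + a l - w l)| ≤ _ := hgl
    rw [hzw] at hgk' hgl'
    exact not_approx_of_separated (by linarith) hε hε1 hΛ hΛε hN (by linarith [hβ k])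
      (hβτ k l hkl) (frequencyMoment_nonneg _ _) (frequencyMoment_nonneg _ _)
      (frequencyMoment_planted_mem hp hε hε1 hN hNp (hα k) (hβ k) (hαβ k) hg
        ((hwsum k hk).trans hρ))
      (frequencyMoment_planted_mem hp hε hε1 hN hNp (hα l) (hβ l) (hαβ l) hg
        ((hwsum l hl).trans hρ)) hgk' hgl'
  have hsum := sum_measureReal_compl_ge (μ := gaussianPi n) (K := K) hmeas' hT (by
    intro g hg k hk l hl hgk hgl
    rcases lt_trichotomy k l with h | h | h
    · exact (hsep g hg k hk l hl h hgk hgl).elim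
    · exact h
    · exact (hsep g hg l hl k hk h hgl hgk).elim)
  set Q : ℕ → ℝ := fun k =>
    (gaussianPi n).real {g : Fin n → ℝ | g + a k - w k ∈ approxSet p ε z}ᶜ with hQ
  have hK0 : (0 : ℝ) ≤ K := Nat.cast_nonneg K
  -- One `κ` is the single level that may be correct (`K * κ = 1`), the other is the atypical set.
  have hQsum : K * (1 - 2 * κ) ≤ ∑ k ∈ Finset.range K, Q k := by
    refine le_trans ?_ hsum
    nlinarith [mul_le_mul_of_nonneg_left htyp hK0]
  -- The change of measure bounds errors below by squares, so the sum is passed to squares by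
  -- Cauchy–Schwarz.
  have hQsq : K * (1 - 2 * κ) ^ 2 ≤ ∑ k ∈ Finset.range K, Q k ^ 2 := by
    have h1 := sq_sum_le_card_mul_sum_sq (s := Finset.range K) (f := Q)
    rw [Finset.card_range] at h1
    have h2 : 0 ≤ K * (1 - 2 * κ) := mul_nonneg hK0 (by linarith)
    have h3 := (pow_le_pow_left₀ h2 hQsum 2).trans h1
    have hKpos : (0 : ℝ) < K := by
      rcases hK0.eq_or_lt with h | h
      · rw [← h] at hκ; simp at hκ
      · exact h
    refine le_of_mul_le_mul_left ?_ hKpos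
    linarith
  calc K * (1 - 2 * κ) ^ 2 * Real.exp (-((M * ε * N) ^ 2 * ρ))
      ≤ (∑ k ∈ Finset.range K, Q k ^ 2) * Real.exp (-((M * ε * N) ^ 2 * ρ)) :=
        mul_le_mul_of_nonneg_right hQsq (Real.exp_pos _).le
    _ = ∑ k ∈ Finset.range K, Q k ^ 2 * Real.exp (-((M * ε * N) ^ 2 * ρ)) := Finset.sum_mul ..
    _ ≤ ∑ k ∈ Finset.range K, (gaussianPi n).real {g | g + a k ∉ approxSet p ε z} := by
        refine Finset.sum_le_sum fun k hk => ?_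
        have h1 := sq_gaussianPi_preimage_sub_le (hmeas k).compl (w k)
        have h2 : {g : Fin n → ℝ | g - w k ∈ {g : Fin n → ℝ | g + a k ∈ approxSet p ε z}ᶜ} =
            {g : Fin n → ℝ | g + a k - w k ∈ approxSet p ε z}ᶜ := by
          ext g
          simp only [Set.mem_ofPred_eq, Set.mem_compl_iff, sub_add_eq_add_sub]
        rw [h2] at h1
        refine le_trans ?_ h1
        refine mul_le_mul_of_nonneg_left ?_ (sq_nonneg _)
        exact Real.exp_le_exp.2 (neg_le_neg (hwsum k (Finset.mem_range.1 hk)))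

/-- Markov's inequality for the leverage scores, in the form used for summation. -/
lemma sum_ge_of_sum_le {n : ℕ} {v f : Fin n → ℝ} (hv : ∀ i, 0 ≤ v i) (hf : ∀ i, 0 ≤ f i)
    {ρ κ R b : ℝ} (hρ : 0 < ρ) (hb : 0 ≤ b) (hR : ∑ i, v i ≤ R) (hRρ : R ≤ κ * n * ρ)
    (h : ∀ i, v i ≤ ρ → b ≤ f i) : (1 - κ) * n * b ≤ ∑ i, f i := by
  -- This linear minorant holds on both sides of the threshold, being nonpositive above it.
  have h1 : ∀ i, b * (1 - v i / ρ) ≤ f i := by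
    intro i
    by_cases hi : v i ≤ ρ
    · refine le_trans ?_ (h i hi)
      exact mul_le_of_le_one_right hb (by linarith [div_nonneg (hv i) hρ.le])
    · refine le_trans ?_ (hf i)
      refine mul_nonpos_of_nonneg_of_nonpos hb ?_
      have := (one_le_div hρ).2 (not_le.1 hi).le
      linarith
  have h2 := Finset.sum_le_sum fun i (_ : i ∈ Finset.univ) => h1 i
  refine le_trans ?_ h2
  rw [← Finset.mul_sum, Finset.sum_sub_distrib, ← Finset.sum_div]
  simp only [Finset.sum_const, Finset.card_univ, Fintype.card_fin, nsmul_eq_mul, mul_one]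
  have h3 : (∑ i, v i) / ρ ≤ κ * n := (div_le_iff₀ hρ).2 (hR.trans hRρ)
  nlinarith [mul_le_mul_of_nonneg_left h3 hb]

/-! ### Averaging over the sketch. -/

lemma LinearSketch.measurable_output {r n : ℕ} {Ω : Type*} [MeasurableSpace Ω]
    (A : LinearSketch r n Ω) : Measurable fun q : Ω × (Fin n → ℝ) => A.output q.1 q.2 := by
  have h : Measurable fun q : Ω × (Fin n → ℝ) => (A.matrix q.1).mulVec q.2 := by
    refine measurable_pi_lambda _ fun i => ?_
    simp only [Matrix.mulVec, dotProduct]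
    exact Finset.measurable_sum _ fun j _ =>
      ((A.measurable_matrix i j).comp measurable_fst).mul
        ((measurable_pi_apply j).comp measurable_snd)
  exact A.measurable_estimate.comp (measurable_fst.prodMk h)

lemma LinearSketch.measurableSet_approx {r n : ℕ} {Ω : Type*} [MeasurableSpace Ω]
    (A : LinearSketch r n Ω) (p ε : ℝ) :
    MeasurableSet {q : Ω × (Fin n → ℝ) | q.2 ∈ approxSet p ε (A.output q.1)} := by
  have hF : Measurable fun q : Ω × (Fin n → ℝ) => frequencyMoment p q.2 :=
    (measurable_frequencyMoment p).comp measurable_snd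
  exact measurableSet_le (A.measurable_output.sub hF).abs (hF.const_mul ε)

/-- The error probability of a sketch on a translate of a random input, averaged over the
randomness of the sketch. -/
lemma LinearSketch.Approximates.lintegral_error_le {r n : ℕ} {Ω : Type*} [MeasurableSpace Ω]
    {A : LinearSketch r n Ω} {P : Measure Ω} [IsProbabilityMeasure P] {p ε δ : ℝ}
    (h : A.Approximates P p ε δ) (μ : Measure (Fin n → ℝ)) [IsProbabilityMeasure μ]
    (a : Fin n → ℝ) :
    ∫⁻ ω, μ {g | g + a ∉ approxSet p ε (A.output ω)} ∂P ≤ ENNReal.ofReal δ := by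
  set B : Set (Ω × (Fin n → ℝ)) := {q | q.2 + a ∈ approxSet p ε (A.output q.1)}ᶜ with hB
  have hBm : MeasurableSet B :=
    (((measurable_fst.prodMk (measurable_snd.add_const a)) (A.measurableSet_approx p ε)) :
      MeasurableSet {q : Ω × (Fin n → ℝ) | q.2 + a ∈ approxSet p ε (A.output q.1)}).compl
  calc ∫⁻ ω, μ {g | g + a ∉ approxSet p ε (A.output ω)} ∂P
      = (P.prod μ) B := (Measure.prod_apply hBm).symm
    _ = ∫⁻ g, P ((fun ω => (ω, g)) ⁻¹' B) ∂μ := Measure.prod_apply_symm hBm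
    _ ≤ ∫⁻ _, ENNReal.ofReal δ ∂μ := by
        refine lintegral_mono fun g => ?_
        have hG : MeasurableSet ((fun ω => (ω, g)) ⁻¹' B) := measurable_prodMk_right hBm
        have h1 := h (g + a)
        have h2 : ((fun ω => (ω, g)) ⁻¹' B)ᶜ =
            {ω | |A.output ω (g + a) - frequencyMoment p (g + a)| ≤
              ε * frequencyMoment p (g + a)} := by
          ext ω
          simp [hB, approxSet]
        rw [← h2, probReal_compl_eq_one_sub hG] at h1
        rw [← ofReal_measureReal]
        exact ENNReal.ofReal_le_ofReal (by linarith)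
    _ = ENNReal.ofReal δ := by simp

/-- The easy half of Yao's principle. The bound `hb` is pointwise in `ω`, so the projections used to
prove it need not be measurable in `ω`. -/
lemma LinearSketch.Approximates.le_of_forall_sum_error_ge {r n K : ℕ} {Ω : Type*}
    [MeasurableSpace Ω] {A : LinearSketch r n Ω} {P : Measure Ω} [IsProbabilityMeasure P]
    {p ε δ b : ℝ} (hδ : 0 ≤ δ) (h : A.Approximates P p ε δ) (μ : Measure (Fin n → ℝ))
    [IsProbabilityMeasure μ] (a : Fin n → ℕ → Fin n → ℝ)
    (hb : ∀ ω, b ≤ ∑ i, ∑ k ∈ Finset.range K,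
      μ.real {g | g + a i k ∉ approxSet p ε (A.output ω)}) :
    b ≤ n * K * δ := by
  have hmeas : ∀ i k, Measurable fun ω => μ {g | g + a i k ∉ approxSet p ε (A.output ω)} := by
    intro i k
    exact measurable_measure_prodMk_left
      (((measurable_fst.prodMk (measurable_snd.add_const (a i k)))
        (A.measurableSet_approx p ε)).compl)
  have h1 : ENNReal.ofReal b ≤ ∫⁻ ω, ∑ i, ∑ k ∈ Finset.range K,
      μ {g | g + a i k ∉ approxSet p ε (A.output ω)} ∂P := by
    calc ENNReal.ofReal b = ∫⁻ _, ENNReal.ofReal b ∂P := by simp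
      _ ≤ _ := by
        refine lintegral_mono fun ω => ?_
        refine (ENNReal.ofReal_le_ofReal (hb ω)).trans (le_of_eq ?_)
        rw [ENNReal.ofReal_sum_of_nonneg fun i _ => Finset.sum_nonneg fun k _ => measureReal_nonneg]
        refine Finset.sum_congr rfl fun i _ => ?_
        rw [ENNReal.ofReal_sum_of_nonneg fun k _ => measureReal_nonneg]
        exact Finset.sum_congr rfl fun k _ => ofReal_measureReal
  rw [lintegral_finsetSum _ fun i _ => Finset.measurable_sum _ fun k _ => hmeas i k] at h1
  have h2 : ENNReal.ofReal b ≤ ENNReal.ofReal (n * K * δ) := by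
    refine h1.trans ?_
    calc _ ≤ ∑ _i : Fin n, ∑ _k ∈ Finset.range K, ENNReal.ofReal δ := by
          refine Finset.sum_le_sum fun i _ => ?_
          rw [lintegral_finsetSum _ fun k _ => hmeas i k]
          exact Finset.sum_le_sum fun k _ => h.lintegral_error_le μ (a i k)
      _ = ENNReal.ofReal (n * K * δ) := by
          simp only [Finset.sum_const, Finset.card_univ, Fintype.card_fin, Finset.card_range,
            nsmul_eq_mul]
          rw [ENNReal.ofReal_mul (by positivity), ENNReal.ofReal_mul (by positivity),
            ENNReal.ofReal_natCast, ENNReal.ofReal_natCast, mul_assoc]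
  exact (ENNReal.ofReal_le_ofReal_iff (by positivity)).1 h2

/-! ### Choice of constants and conclusion. -/

/-- Chebyshev, with `2304 = 48²` and `576 = 24²`; `N² ≤ n` puts both terms over `(εN)²`. -/
lemma gaussianPi_compl_typicalSet_le_of_large {n : ℕ} {p : ℝ} (hp : 2 < p) (hn : 0 < n) (i : Fin n)
    {ε N κ : ℝ} (hε : 0 < ε) (hN : N = (n : ℝ) ^ (1 / p))
    (hκ : 2304 * Var[fun x : ℝ => |x| ^ p; gaussianReal 0 1] + 576 ≤ κ * (ε * N) ^ 2) :
    (gaussianPi n).real (typicalSet p i (ε * n / 48) (ε * N / 24))ᶜ ≤ κ := by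
  have hn' : (0 : ℝ) < n := Nat.cast_pos.2 hn
  have hn1 : (1 : ℝ) ≤ n := by exact_mod_cast hn
  have hN0 : 0 < N := hN ▸ Real.rpow_pos_of_pos hn' _
  set V := Var[fun x : ℝ => |x| ^ p; gaussianReal 0 1] with hV
  have hV0 : 0 ≤ V := variance_nonneg _ _
  have hNn : N ^ 2 ≤ n := by
    rw [hN, ← Real.rpow_natCast, ← Real.rpow_mul hn'.le]
    refine Real.rpow_le_self_of_one_le hn1 ?_
    rw [one_div, inv_mul_le_iff₀ (by linarith)]
    push_cast
    linarith
  refine (gaussianPi_compl_typicalSet_le (by linarith) i (by positivity) (by positivity)).trans ?_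
  rw [← hV]
  have h1 : n * V / (ε * n / 48) ^ 2 = 2304 * V / (ε ^ 2 * n) := by field_simp; norm_num
  have h2 : 1 / (ε * N / 24) ^ 2 = 576 / (ε * N) ^ 2 := by field_simp; norm_num
  have h3 : 2304 * V / (ε ^ 2 * n) ≤ 2304 * V / (ε * N) ^ 2 := by
    gcongr
    rw [mul_pow]
    gcongr
  rw [h1, h2]
  calc 2304 * V / (ε ^ 2 * n) + 576 / (ε * N) ^ 2
      ≤ 2304 * V / (ε * N) ^ 2 + 576 / (ε * N) ^ 2 := by linarith
    _ = (2304 * V + 576) / (ε * N) ^ 2 := by ring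
    _ ≤ κ := (div_le_iff₀ (by positivity)).2 hκ

lemma rows_lower_bound {p : ℝ} (hp : 2 < p) {ε₀ δ₀ : ℝ} (hε₀ : 0 ≤ ε₀) (hε₀1 : ε₀ < 1)
    (hδ₀ : 0 < δ₀) (hδ₀1 : δ₀ < 1) :
    ∃ C : ℝ, 0 < C ∧ ∃ c : ℝ, 0 < c ∧
      ∀ (n r : ℕ) (ε δ : ℝ), 0 < ε → ε ≤ ε₀ → 0 < δ → δ ≤ δ₀ →
        Real.log (1 / δ) ≤ C * ε ^ 2 * (n : ℝ) ^ (2 / p) →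
        ∀ (Ω : Type*) [MeasurableSpace Ω] (P : Measure Ω) [IsProbabilityMeasure P]
          (A : LinearSketch r n Ω), A.Approximates P p ε δ →
          c * ((n : ℝ) ^ (1 - 2 / p) * (ε ^ 2)⁻¹ * Real.log (1 / δ)) ≤ (r : ℝ) := by
  have hs1 : 0 < 1 - √δ₀ := by
    have : √δ₀ < 1 := by rw [Real.sqrt_lt' one_pos]; simpa using hδ₀1
    linarith
  -- Since `δ₀` may be close to `1`, two levels are not enough: `K` is taken so large that `1 - 5κ >
  -- √δ₀`.
  obtain ⟨K, hK⟩ := exists_nat_gt (5 / (1 - √δ₀))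
  have hK0 : (0 : ℝ) < K := lt_trans (by positivity) hK
  set κ : ℝ := 1 / K with hκ
  have hκ0 : 0 < κ := by positivity
  have hKκ : K * κ = 1 := by rw [hκ]; field_simp
  have hκs : √δ₀ < 1 - 5 * κ := by
    rw [div_lt_iff₀ hs1] at hK
    have h1 : κ * 5 < κ * (K * (1 - √δ₀)) := mul_lt_mul_of_pos_left hK hκ0
    have h2 : κ * (K * (1 - √δ₀)) = 1 - √δ₀ := by
      rw [← mul_assoc, mul_comm κ, hKκ, one_mul]
    linarith
  have hκ2 : κ ≤ 1 / 5 := by linarith [Real.sqrt_nonneg δ₀]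
  set Λ : ℝ := 2 / (1 - ε₀) with hΛ
  have hΛ2 : 2 ≤ Λ := by rw [hΛ, le_div_iff₀ (by linarith)]; linarith
  obtain ⟨M, hM, hlev⟩ := exists_levels hp hΛ2 (Nat.cast_pos.1 hK0)
  set V := Var[fun x : ℝ => |x| ^ p; gaussianReal 0 1] with hV
  have hV0 : 0 ≤ V := variance_nonneg _ _
  have hlog₀ : 0 < Real.log (1 / δ₀) := Real.log_pos ((one_lt_div hδ₀).2 hδ₀1)
  -- The first bound keeps the shifts below `εN/24`, as `ℓ/2 ≤ (εN)²/576`; the second makes `εN`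
  -- large enough for typicality, as `ℓ ≥ log (1/δ₀)`.
  set C := min (1 / 288) (κ * Real.log (1 / δ₀) / (2304 * V + 576)) with hC
  refine ⟨C, by positivity, κ / (2 * M ^ 2), by positivity, ?_⟩
  intro n r ε δ hε hεε₀ hδ hδδ₀ hlog Ω _ P _ A hA
  have hε1 : ε < 1 := by linarith
  have hlogδ : Real.log (1 / δ₀) ≤ Real.log (1 / δ) :=
    Real.log_le_log (by positivity) (one_div_le_one_div_of_le hδ hδδ₀)
  set ℓ := Real.log (1 / δ) with hℓ
  have hℓ0 : 0 < ℓ := by linarith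
  have hn : 0 < n := by
    rcases Nat.eq_zero_or_pos n with h | h
    · rw [h, Nat.cast_zero, Real.zero_rpow (by positivity), mul_zero] at hlog
      linarith
    · exact h
  have hn' : (0 : ℝ) < n := Nat.cast_pos.2 hn
  set N := (n : ℝ) ^ (1 / p) with hN
  have hN0 : 0 < N := Real.rpow_pos_of_pos hn' _
  have hNp : N ^ p = n := by rw [hN, one_div, Real.rpow_inv_rpow hn'.le (by linarith)]
  have hN2 : (n : ℝ) ^ (2 / p) = N ^ 2 := by
    rw [hN, ← Real.rpow_natCast, ← Real.rpow_mul hn'.le]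
    congr 1
    push_cast
    ring
  rw [hN2] at hlog
  by_contra! hr
  -- The threshold at which the change of measure costs exactly `exp (-ℓ/2) = √δ`.
  set ρ := ℓ / (2 * (M * ε * N) ^ 2) with hρ
  have hρ0 : 0 < ρ := by positivity
  have hDρ : (M * ε * N) ^ 2 * ρ = ℓ / 2 := by rw [hρ]; field_simp
  have hrρ : (r : ℝ) ≤ κ * n * ρ := by
    refine hr.le.trans (le_of_eq ?_)
    rw [Real.rpow_sub hn', Real.rpow_one, hN2, hρ]
    field_simp
  have hρw : (M * ε * N) ^ 2 * ρ ≤ (ε * N / 24) ^ 2 := by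
    rw [hDρ]
    have : C * ε ^ 2 * N ^ 2 ≤ 1 / 288 * ε ^ 2 * N ^ 2 := by
      gcongr
      exact min_le_left _ _
    linarith
  have htyp : 2304 * V + 576 ≤ κ * (ε * N) ^ 2 := by
    have h1 : C * ε ^ 2 * N ^ 2 ≤ κ * Real.log (1 / δ₀) / (2304 * V + 576) * ε ^ 2 * N ^ 2 := by
      gcongr
      exact min_le_right _ _
    have h2 : Real.log (1 / δ₀) ≤
        Real.log (1 / δ₀) * (κ * (ε * N) ^ 2 / (2304 * V + 576)) := by
      refine (hlogδ.trans (hlog.trans h1)).trans (le_of_eq ?_)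
      ring
    have h3 := le_of_mul_le_mul_left ((mul_one _).trans_le h2) hlog₀
    rwa [one_le_div (by positivity)] at h3
  have hΛε : 2 ≤ Λ * (1 - ε) := by
    calc (2 : ℝ) = Λ * (1 - ε₀) := by rw [hΛ, div_mul_cancel₀]; linarith
      _ ≤ Λ * (1 - ε) := by gcongr
  obtain ⟨α, β, hβ, hα, hαβ, hβτ, hαM⟩ := hlev ε hε hε1
  have hexp : Real.exp (-((M * ε * N) ^ 2 * ρ)) = √δ := by
    rw [hDρ, hℓ, one_div, Real.log_inv, Real.sqrt_eq_rpow, Real.rpow_def_of_pos hδ]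
    congr 1
    ring
  have hmain := hA.le_of_forall_sum_error_ge (K := K)
    (b := (1 - κ) * n * (K * (1 - 2 * κ) ^ 2 * √δ)) hδ.le (gaussianPi n)
    (fun i k => (α k * N) • Pi.single i 1) (by
      intro ω
      obtain ⟨q, hq, hqr⟩ := exists_rowSpace_proj (A.matrix ω)
      refine sum_ge_of_sum_le (v := fun i => ∑ j, q i j ^ 2)
        (fun i => Finset.sum_nonneg fun _ _ => sq_nonneg _)
        (fun i => Finset.sum_nonneg fun _ _ => measureReal_nonneg) hρ0 (by positivity) hqr hrρ
        fun i hi => ?_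
      rw [← hexp]
      exact sum_gaussianPi_error_ge hp hε hε1 hΛ2 hΛε hN0 hNp hβ hα hαβ hβτ hαM (A.matrix ω)
        (A.measurable_estimate.comp measurable_prodMk_left) i (hq i) hi hρw hKκ (by linarith)
        (gaussianPi_compl_typicalSet_le_of_large hp hn i hε hN htyp))
  have hsq : √δ * √δ = δ := Real.mul_self_sqrt hδ.le
  have hsδ : 0 < √δ := Real.sqrt_pos.2 hδ
  have h1 : (1 - κ) * (1 - 2 * κ) ^ 2 ≤ √δ := by
    have h2 : n * K * √δ * ((1 - κ) * (1 - 2 * κ) ^ 2) ≤ n * K * √δ * √δ := by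
      calc _ = (1 - κ) * n * (K * (1 - 2 * κ) ^ 2 * √δ) := by ring
        _ ≤ n * K * δ := hmain
        _ = _ := by rw [mul_assoc _ √δ, hsq]
    exact le_of_mul_le_mul_left h2 (by positivity)
  have h2 : √δ ≤ √δ₀ := Real.sqrt_le_sqrt hδδ₀
  have h3 : 1 - 5 * κ ≤ (1 - κ) * (1 - 2 * κ) ^ 2 := by
    have : (1 - κ) * (1 - 2 * κ) ^ 2 = 1 - 5 * κ + κ ^ 2 * (8 - 4 * κ) := by ring
    rw [this]
    have : 0 ≤ κ ^ 2 * (8 - 4 * κ) := mul_nonneg (sq_nonneg _) (by linarith)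
    linarith
  linarith

theorem mainTheorem4 (p : ℝ) (hp : 2 < p) (ε₀ δ₀ : ℝ) (hε₀ : ε₀ < 1) (hδ₀ : δ₀ < 1) :
    ∃ C : ℝ, 0 < C ∧ ∃ c : ℝ, 0 < c ∧
      ∀ (n r : ℕ) (ε δ : ℝ), 0 < ε → ε ≤ ε₀ → 0 < δ → δ ≤ δ₀ →
        Real.log (1 / δ) ≤ C * ε ^ 2 * (n : ℝ) ^ (2 / p) →
        ∀ (Ω : Type*) [MeasurableSpace Ω] (P : Measure Ω) [IsProbabilityMeasure P]
          (A : LinearSketch r n Ω), A.Approximates P p ε δ →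
          c * ((n : ℝ) ^ (1 - 2 / p) * (ε ^ 2)⁻¹ * Real.log (1 / δ)) ≤ (r : ℝ) := by
  -- Here `ε₀` and `δ₀` may be nonpositive; enlarging them to at least `1/2` is harmless.
  obtain ⟨C, hC, c, hc, h⟩ := rows_lower_bound hp (ε₀ := max ε₀ (1 / 2)) (δ₀ := max δ₀ (1 / 2))
    (le_max_of_le_right (by norm_num)) (max_lt hε₀ (by norm_num))
    (lt_max_of_lt_right (by norm_num)) (max_lt hδ₀ (by norm_num))
  exact ⟨C, hC, c, hc, fun n r ε δ hε hεε₀ hδ hδδ₀ =>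
    h n r ε δ hε (le_max_of_le_left hεε₀) hδ (le_max_of_le_left hδδ₀)⟩
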